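/- Let $\mathbb H$ be the upper half plane, $q=e^{2\pi i z}$, $D=\frac{1}{2\pi i}\frac{d}{dz}=q\frac{d}{dq}$, let $E_2,E_4,E_6$ be the normalized Eisenstein series of level one, and let $\Delta=q\prod_{n\ge1}(1-q^n)^{24}$, $\Delta^{1/2}=q^{1/2}\prod_{n\ge 1}(1-q^n)^{12}$. For $k\ge 1$ put $\mu_k^*=\frac{12(6k-1)(6k+7)}{k(k+1)}$, and define polynomials by $P_0^*=1$, $P_1^*=x$, $Q_0^*=0$, $Q_1^*=1$ and $P_{k+1}^*=xP_k^*+\mu_k^*P_{k-1}^*$, $Q_{k+1}^*=xQ_k^*+\mu_k^*Q_{k-1}^*$ for $k\ge1$. The Kaneko–Koike form of weight $6k+2$ and depth $1$ is, for $k\ge1$, $$f_{1,6k+2}=\Delta^{\frac{k-1}{2}}P_{k-1}^*\!\left(\frac{E_6}{\Delta^{1/2}}\right)\left(-\frac{D(E_6)}{504}\right)-\Delta^{\frac k2}Q_{k-1}^*\!\left(\frac{E_6}{\Delta^{1/2}}\right)E_2 .$$ Let $\widetilde M_{\ell,w}$ be the space of functions $\sum_{j=0}^{\ell}g_jE_2^j$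 on $\mathbb H$ with $g_j$ a modular form of weight $w-2j$ on $\mathrm{SL}_2(\mathbb Z)$, and let $m=\dim_{\mathbb C}\widetilde M_{\ell,w}$. An element $f=\sum_{n\ge0}a_nq^n$ of $\widetilde M_{\ell,w}$ that lies in no $\widetilde M_{\ell',w}$ with $\ell'<\ell$ is called extremal of weight $w$ and depth $\ell$ if $a_0=\dots=a_{m-2}=0$ and $a_{m-1}\ne0$. Let $k\ge0$ be an integer, and let $f$ be either an extremal quasimodular form of weight $6k+2$ and depth $1$ or, if $k\ge1$, the form $f_{1,6k+2}$. Let $U\subseteq\mathbb H$ be any open set on which $E_4$ has no zeros and on which there is a holomorphic branch of $E_4^{1/2}$ (for example a half plane $\operatorname{Im} z>c$ with the branch that tends to $1$ at $i\infty$). Then for every such branch the function $\varphi=f\,\Delta^{-k/2}E_4^{-1/2}$ satisfies on $U$ $$D^2\varphi=\left(\left(\frac{k^2}{4}-\frac1{12}\right)E_4+\frac1{12}\left(\frac{E_6}{E_4}\right)^2\right)\varphi .$$ -/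

import Mathlib

open UpperHalfPlane ModularForm EisensteinSeries
open scoped MatrixGroups Manifold Derivative

noncomputable section

namespace KanekoKoike

/-- The space of quasimodular forms of weight `w` and depth at most `ℓ` on `SL(2, ℤ)`: the functions
`∑_{j ≤ ℓ} g_j E₂ ^ j` on the upper half plane, where `g_j` is a modular form of weight `w - 2 j`. -/
def quasimodularForms (ℓ w : ℕ) : Submodule ℂ (ℍ → ℂ) where
  carrier := {f | ∃ g : (j : ℕ) → ModularForm 𝒮ℒ ((w : ℤ) - 2 * (j : ℤ)),
    ∀ z, f z = ∑ j ∈ Finset.range (ℓ + 1), g j z * E2 z ^ j}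
  add_mem' := by
    rintro _ _ ⟨g, hg⟩ ⟨h, hh⟩
    exact ⟨fun j => g j + h j, fun z => by
      simp [hg, hh, add_mul, Finset.sum_add_distrib]⟩
  zero_mem' := ⟨fun _ => 0, fun z => by simp⟩
  smul_mem' := by
    rintro c _ ⟨g, hg⟩
    exact ⟨fun j => c • g j, fun z => by
      simp [hg, Finset.mul_sum, mul_assoc]⟩

/-- `f` is an extremal quasimodular form of depth exactly `ℓ` and weight `w`: with `m` the dimension
of the space of quasimodular forms of weight `w` and depth at most `ℓ`, the Fourier expansion
`f = ∑ aₙ qⁿ`, `q = exp (2πiz)`, has `a₀ = ⋯ = a_{m-2} = 0` and `a_{m-1} ≠ 0`. -/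
structure IsExtremal (ℓ w : ℕ) (f : ℍ → ℂ) : Prop where
  mem : f ∈ quasimodularForms ℓ w
  notMem : ∀ ℓ' < ℓ, f ∉ quasimodularForms ℓ' w
  coeff_eq_zero : ∀ n : ℕ, n + 1 < Module.finrank ℂ (quasimodularForms ℓ w) →
    (qExpansion 1 f).coeff n = 0
  coeff_ne_zero : (qExpansion 1 f).coeff (Module.finrank ℂ (quasimodularForms ℓ w) - 1) ≠ 0

/-- The normalized square root `Δ^{1/2} = q^{1/2} ∏ (1 - qⁿ)¹²` of the discriminant. -/
def sqrtDelta (z : ℍ) : ℂ := eta z ^ 12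

theorem sqrtDelta_sq (z : ℍ) : sqrtDelta z ^ 2 = discriminant z := by
  simp only [sqrtDelta, discriminant]; ring

theorem sqrtDelta_ne_zero (z : ℍ) : sqrtDelta z ≠ 0 :=
  pow_ne_zero _ (eta_ne_zero z.2)

/-- `μ*_k = 12 (6k - 1) (6k + 7) / (k (k + 1))`, for `k ≥ 1`. -/
def muStar (k : ℕ) : ℂ := 12 * (6 * k - 1) * (6 * k + 7) / (k * (k + 1))

/-- `P*_0 = 1`, `P*_1 = x`, `P*_{k+1} = x P*_k + μ*_k P*_{k-1}`. -/
def PStar : ℕ → Polynomial ℂ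
  | 0 => 1
  | 1 => Polynomial.X
  | k + 2 => Polynomial.X * PStar (k + 1) + Polynomial.C (muStar (k + 1)) * PStar k

/-- `Q*_0 = 0`, `Q*_1 = 1`, `Q*_{k+1} = x Q*_k + μ*_k Q*_{k-1}`. -/
def QStar : ℕ → Polynomial ℂ
  | 0 => 0
  | 1 => 1
  | k + 2 => Polynomial.X * QStar (k + 1) + Polynomial.C (muStar (k + 1)) * QStar k

/-- The Kaneko–Koike form of weight `6k + 2` and depth `1`, for `k ≥ 1`:
`Δ^{(k-1)/2} P*_{k-1}(E₆ / Δ^{1/2}) (-D(E₆) / 504) - Δ^{k/2} Q*_{k-1}(E₆ / Δ^{1/2}) E₂`. -/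
def kkForm (k : ℕ) (z : ℍ) : ℂ :=
  sqrtDelta z ^ (k - 1) * (PStar (k - 1)).eval (E₆ z / sqrtDelta z) * (-(D (⇑E₆) z) / 504)
    - sqrtDelta z ^ k * (QStar (k - 1)).eval (E₆ z / sqrtDelta z) * E2 z

/-- `r` is a holomorphic branch of `E₄^{1/2}` on the open set `U`, on which `E₄` has no zeros. -/
structure IsSqrtE4On (U : Set ℍ) (r : ℍ → ℂ) : Prop where
  isOpen : IsOpen U
  ne_zero : ∀ z ∈ U, E₄ z ≠ 0
  mdifferentiableOn : MDiff[U] r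
  sq_eq : ∀ z ∈ U, r z ^ 2 = E₄ z

/-- The principal branch, on the open set where `E₄` avoids the negative real axis and `0`. As `E₄`
tends to `1` at `i∞`, this set contains a half-plane `Im z > c`, where it gives the normalized root
in `1 + q ℂ[[q]]`. -/
theorem isSqrtE4On_cpow :
    IsSqrtE4On {z | E₄ z ∈ Complex.slitPlane} (fun z => E₄ z ^ (1 / 2 : ℂ)) where
  isOpen := Complex.isOpen_slitPlane.preimage (ModularFormClass.holo E₄).continuous
  ne_zero _ hz := Complex.slitPlane_ne_zero hz
  mdifferentiableOn z hz := by
    have h1 : MDiffAt (fun w : ℂ => w ^ (1 / 2 : ℂ)) (E₄ z) :=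
      (DifferentiableAt.cpow_const differentiableAt_id hz).mdifferentiableAt
    exact (h1.comp z (ModularFormClass.holo E₄ z)).mdifferentiableWithinAt
  sq_eq z _ := by
    rw [← Complex.cpow_nat_mul]; norm_num

/-- The function `f Δ^{-k/2} E₄^{-1/2}`, with `r` as the branch of `E₄^{1/2}`. -/
def phi (k : ℕ) (f r : ℍ → ℂ) (z : ℍ) : ℂ := f z * (sqrtDelta z ^ k)⁻¹ * (r z)⁻¹

end KanekoKoike

end

/-! Write `f_k` for `E2` when k = 0 and for `kkForm k` when k ≥ 1. Neighbours `f_k`, `f_{k+1}`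
satisfy a pair of first order equations (`Ladder`): multiplied by `E₄`, the Serre derivatives with
parameters 6k+1 and 6k+7 (weight minus depth) are combinations of `f_k` and `f_{k+1}` with
coefficients built from `E₆` and Δ. After division by Δ^{k/2} E₄^{1/2} this becomes a linear system
for φ_k and φ_{k+1}. Eliminating φ_{k+1}, with Ramanujan's formulas for D of `E2`, `E₄`, `E₆` and
1728 Δ = E₄³ - E₆², gives the second order equation (`Ladder.D_D_phi`). Only the product ab of the
two coupling constants enters.

The system holds for `E2` by Ramanujan (`ladder_zero`) and climbs by one rung under the three-term
recurrence of the forms (`Ladder.next`, `ladder_succ`).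

For an extremal f the point is uniqueness up to a scalar. The space has dimension k+1, so f has
order exactly k at infinity; climbing the ladder raises the vanishing order by one, so `f_k`
vanishes to order at least k; and a form vanishing to order k+1 is zero (`IsQuasi.eq_zero`, a
Wronskian argument with the Sturm bound). Hence f is a nonzero multiple of `f_k`, and the system is
stable under scaling. -/

noncomputable section

namespace KanekoKoike

open Function Derivative

/-! ### q-expansions, with D acting as q d/dq -/

/-- Holomorphic functions on the upper half plane which are `1`-periodic and bounded at `i∞`. -/
structure IsQHolo (f : ℍ → ℂ) : Prop where
  mdiff : MDiff f
  periodic : Periodic (f ∘ ofComplex) (1 : ℝ)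
  bdd : IsBoundedAtImInfty f

namespace IsQHolo

variable {f g : ℍ → ℂ}

theorem analyticAt (hf : IsQHolo f) : AnalyticAt ℂ (cuspFunction 1 f) 0 :=
  analyticAt_cuspFunction_zero one_pos hf.periodic hf.mdiff hf.bdd

theorem add (hf : IsQHolo f) (hg : IsQHolo g) : IsQHolo (f + g) where
  mdiff := hf.mdiff.add hg.mdiff
  periodic := hf.periodic.add hg.periodic
  bdd := Filter.BoundedAtFilter.add hf.bdd hg.bdd

theorem mul (hf : IsQHolo f) (hg : IsQHolo g) : IsQHolo (f * g) where
  mdiff := hf.mdiff.mul hg.mdiff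
  periodic := hf.periodic.mul hg.periodic
  bdd := Filter.BoundedAtFilter.mul hf.bdd hg.bdd

theorem smul (c : ℂ) (hf : IsQHolo f) : IsQHolo (c • f) where
  mdiff := hf.mdiff.const_smul c
  periodic := hf.periodic.smul c
  bdd := Filter.BoundedAtFilter.smul c hf.bdd

theorem neg (hf : IsQHolo f) : IsQHolo (-f) := by
  simpa using hf.smul (-1)

theorem sub (hf : IsQHolo f) (hg : IsQHolo g) : IsQHolo (f - g) := by
  simpa [sub_eq_add_neg] using hf.add hg.neg

theorem qExpansion_add (hf : IsQHolo f) (hg : IsQHolo g) :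
    qExpansion 1 (f + g) = qExpansion 1 f + qExpansion 1 g :=
  UpperHalfPlane.qExpansion_add hf.analyticAt hg.analyticAt

theorem qExpansion_sub (hf : IsQHolo f) (hg : IsQHolo g) :
    qExpansion 1 (f - g) = qExpansion 1 f - qExpansion 1 g :=
  UpperHalfPlane.qExpansion_sub hf.analyticAt hg.analyticAt

theorem qExpansion_mul (hf : IsQHolo f) (hg : IsQHolo g) :
    qExpansion 1 (f * g) = qExpansion 1 f * qExpansion 1 g :=
  UpperHalfPlane.qExpansion_mul hf.analyticAt hg.analyticAt

theorem qExpansion_smul (hf : IsQHolo f) (c : ℂ) :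
    qExpansion 1 (c • f) = c • qExpansion 1 f :=
  UpperHalfPlane.qExpansion_smul hf.analyticAt c

theorem eq_zero_of_qExpansion (hf : IsQHolo f) (h : qExpansion 1 f = 0) : f = 0 :=
  (qExpansion_eq_zero_iff one_pos hf.periodic hf.mdiff hf.bdd).mp h

theorem apply_eq (hf : IsQHolo f) (z : ℍ) :
    cuspFunction 1 f (Periodic.qParam 1 z) = f z :=
  eq_cuspFunction z one_ne_zero hf.periodic

theorem norm_qParam_lt (z : ℍ) : ‖Periodic.qParam 1 (z : ℂ)‖ < 1 :=
  Periodic.norm_qParam_lt_one one_pos z.im_pos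

/-- In the coordinate `q`, the operator `D` is `q d/dq`. -/
theorem D_apply (hf : IsQHolo f) (z : ℍ) :
    D f z = Periodic.qParam 1 z * deriv (cuspFunction 1 f) (Periodic.qParam 1 z) := by
  have hev : f ∘ ofComplex =ᶠ[nhds (z : ℂ)] cuspFunction 1 f ∘ Periodic.qParam 1 := by
    filter_upwards [isOpen_upperHalfPlaneSet.mem_nhds z.im_pos] with w hw
    simp only [comp_apply, ofComplex_apply_of_im_pos hw]
    exact (hf.apply_eq ⟨w, hw⟩).symm
  have hd : HasDerivAt (Periodic.qParam 1)
      (2 * Real.pi * Complex.I * Periodic.qParam 1 z) (z : ℂ) := by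
    have h1 : HasDerivAt (fun w : ℂ => 2 * Real.pi * Complex.I * w / (1 : ℝ))
        (2 * Real.pi * Complex.I) (z : ℂ) := by
      simpa using (hasDerivAt_id (z : ℂ)).const_mul (2 * Real.pi * Complex.I)
    have h2 := h1.cexp
    convert! h2 using 1
    exact mul_comm _ _
  have hF : DifferentiableAt ℂ (cuspFunction 1 f) (Periodic.qParam 1 z) :=
    differentiableAt_cuspFunction one_pos hf.periodic hf.mdiff hf.bdd (norm_qParam_lt z)
  rw [normalizedDerivOfComplex, hev.deriv_eq, (hF.hasDerivAt.comp (z : ℂ) hd).deriv]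
  have := Complex.two_pi_I_ne_zero
  field_simp

theorem analyticAt_deriv (hf : IsQHolo f) :
    AnalyticAt ℂ (fun q => q * deriv (cuspFunction 1 f) q) 0 :=
  analyticAt_id.mul hf.analyticAt.deriv

theorem tendsto_D (hf : IsQHolo f) : Filter.Tendsto (D f) atImInfty (nhds 0) := by
  have h := hf.analyticAt_deriv.continuousAt.tendsto.comp (qParam_tendsto_atImInfty one_pos)
  simp only [zero_mul] at h
  exact h.congr fun z => (hf.D_apply z).symm

theorem normalizedDeriv (hf : IsQHolo f) : IsQHolo (D f) where
  mdiff := normalizedDerivOfComplex_mdifferentiable hf.mdiff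
  bdd := hf.tendsto_D.isBigO_one ℝ
  periodic w := by
    by_cases hw : 0 < w.im
    · have hw' : 0 < (w + (1 : ℝ)).im := by simpa using hw
      simp only [comp_apply, ofComplex_apply_of_im_pos hw, ofComplex_apply_of_im_pos hw']
      rw [hf.D_apply, hf.D_apply]
      have h : Periodic.qParam 1 (w + (1 : ℝ)) = Periodic.qParam 1 w := by
        simp [Periodic.qParam, mul_add, Complex.exp_periodic _]
      simp only [h]
    -- Off the half plane `ofComplex` takes a constant default value, so periodicity is trivial
    -- there.
    · have hw' : (w + (1 : ℝ)).im ≤ 0 := by simpa using hw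
      simp only [comp_apply, ofComplex_apply_of_im_nonpos hw',
        ofComplex_apply_of_im_nonpos (not_lt.mp hw)]

/-- Away from q = 0 this is `D_apply` read through a logarithm of q; both sides are continuous at 0,
which settles the remaining point. -/
theorem cuspFunction_D (hf : IsQHolo f) :
    cuspFunction 1 (D f) =ᶠ[nhds 0]
      ((id : ℂ → ℂ) * deriv (cuspFunction 1 f)) := by
  have h1 : ∀ᶠ q in nhdsWithin (0 : ℂ) {0}ᶜ,
      cuspFunction 1 (D f) q =
        ((id : ℂ → ℂ) * deriv (cuspFunction 1 f)) q := by
    filter_upwards [self_mem_nhdsWithin, mem_nhdsWithin_of_mem_nhds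
      (Metric.ball_mem_nhds (0 : ℂ) one_pos)] with q hq hq1
    have him := Periodic.im_invQParam_pos_of_norm_lt_one one_pos
      (by simpa [dist_zero_right] using hq1) hq
    have h2 := hf.normalizedDeriv.apply_eq ⟨_, him⟩
    have h3 := hf.D_apply ⟨_, him⟩
    have h4 : Periodic.qParam 1 (Periodic.invQParam 1 q) = q :=
      Periodic.qParam_right_inv one_ne_zero hq
    simp only [h4] at h2 h3
    rw [h2, h3]; rfl
  exact (hf.normalizedDeriv.analyticAt.continuousAt.eventuallyEq_nhds_iff_eventuallyEq_nhdsNE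
    (analyticAt_id.mul hf.analyticAt.deriv).continuousAt).mp h1

theorem coeff_D (hf : IsQHolo f) (n : ℕ) :
    (qExpansion 1 (D f)).coeff n =
      n * (qExpansion 1 f).coeff n := by
  simp only [qExpansion_coeff]
  rw [hf.cuspFunction_D.iteratedDeriv_eq,
    iteratedDeriv_mul analyticAt_id.contDiffAt hf.analyticAt.deriv.contDiffAt]
  cases n with
  | zero => simp
  | succ n =>
    -- In Leibniz' rule for q · F'(q) at q = 0, only the term that differentiates the factor q
    -- exactly once survives.
    rw [Finset.sum_eq_single 1]
    · rw [iteratedDeriv_one, Nat.add_sub_cancel, ← iteratedDeriv_succ']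
      simp
      ring
    · intro i _ hi
      rcases i with _ | _ | i
      · simp
      · exact absurd rfl hi
      · rw [iteratedDeriv_succ', iteratedDeriv_succ']
        simp [show deriv (id : ℂ → ℂ) = fun _ => 1 from funext deriv_id]
    · simp

theorem qExpansion_D (hf : IsQHolo f) :
    qExpansion 1 (D f) =
      PowerSeries.X * PowerSeries.derivative ℂ (qExpansion 1 f) := by
  ext n
  rw [hf.coeff_D]
  cases n with
  | zero => simp
  | succ n => simp [PowerSeries.coeff_succ_X_mul, PowerSeries.coeff_derivative, mul_comm]

end IsQHolo

/-! ### Modular forms, `E2` and the Serre derivative -/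

theorem isQHolo_modularForm {k : ℤ} (f : ModularForm 𝒮ℒ k) : IsQHolo f where
  mdiff := ModularFormClass.holo f
  periodic := SlashInvariantFormClass.periodic_comp_ofComplex f one_mem_strictPeriods_SL
  bdd := ModularFormClass.bdd_at_infty f

theorem isQHolo_E2 : IsQHolo E2 where
  mdiff := E2_mdifferentiable
  bdd := isBoundedAtImInfty_E2
  periodic w := by
    by_cases hw : 0 < w.im
    · have hw' : 0 < (w + (1 : ℝ)).im := by simpa using hw
      simp only [comp_apply, ofComplex_apply_of_im_pos hw, ofComplex_apply_of_im_pos hw']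
      rw [E2_eq_tsum_cexp, E2_eq_tsum_cexp]
      have h : Complex.exp (2 * Real.pi * Complex.I * (w + 1)) =
          Complex.exp (2 * Real.pi * Complex.I * w) := by
        rw [mul_add, mul_one, Complex.exp_periodic]
      simp [h]
    · have hw' : (w + (1 : ℝ)).im ≤ 0 := by simpa using hw
      simp only [comp_apply, ofComplex_apply_of_im_nonpos hw',
        ofComplex_apply_of_im_nonpos (not_lt.mp hw)]

theorem exists_hasSum_E2 : ∃ c : ℕ → ℂ, c 0 = 1 ∧
    ∀ z : ℍ, HasSum (fun m => c m • Periodic.qParam 1 z ^ m) (E2 z) := by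
  refine ⟨fun m => if m = 0 then 1 else -24 * ArithmeticFunction.sigma 1 m, if_pos rfl,
    fun z => ?_⟩
  have h := hasSum_qExpansion_E2 (z := z)
  have hq : Periodic.qParam 1 (z : ℂ) = Complex.exp (2 * Real.pi * Complex.I * z) := by
    rw [Periodic.qParam, Complex.ofReal_one, div_one]
  rw [hq]
  exact h

theorem qExpansion_E2_coeff_zero : (qExpansion 1 E2).coeff 0 = 1 := by
  obtain ⟨c, hc, h⟩ := exists_hasSum_E2
  have h0 := (hasFPowerSeriesOnBall_cuspFunction one_pos isQHolo_E2.analyticAt h).coeff_zero ![]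
  rw [qExpansion_coeff, iteratedDeriv_zero, ← h0]
  simp [hc]

/-- A `1`-periodic holomorphic function, bounded at `i∞` and invariant under the weight `k` action
of `SL(2, ℤ)`, as a modular form. -/
def IsQHolo.toModularForm {k : ℤ} {f : ℍ → ℂ} (hf : IsQHolo f)
    (h : ∀ γ : SL(2, ℤ), f ∣[k] γ = f) : ModularForm 𝒮ℒ k where
  toFun := f
  slash_action_eq' := fun _ ⟨γ, hγ⟩ => hγ ▸ h γ
  holo' := hf.mdiff
  bdd_at_cusps' {c} hc := by
    rw [Subgroup.IsArithmetic.isCusp_iff_isCusp_SL2Z] at hc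
    rw [OnePoint.isBoundedAt_iff_forall_SL2Z hc]
    -- Every cusp is equivalent to infinity, and slash invariance moves the bound there.
    intro γ _
    rw [h γ]
    exact hf.bdd

theorem slash_modularForm {k : ℤ} (f : ModularForm 𝒮ℒ k) (γ : SL(2, ℤ)) : ⇑f ∣[k] γ = f :=
  f.slash_action_eq' _ ⟨γ, rfl⟩

theorem serreDerivative_eq_sub (k : ℂ) (f : ℍ → ℂ) :
    serreDerivative k f = D f - (k * 12⁻¹) • (E2 * f) := by
  ext z
  simp [mul_assoc]

theorem IsQHolo.serreDerivative {f : ℍ → ℂ} (hf : IsQHolo f) (k : ℂ) :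
    IsQHolo (serreDerivative k f) := by
  rw [serreDerivative_eq_sub]
  exact hf.normalizedDeriv.sub ((isQHolo_E2.mul hf).smul _)

theorem IsQHolo.coeff_zero_serreDerivative {f : ℍ → ℂ} (hf : IsQHolo f) (k : ℂ) :
    (qExpansion 1 (Derivative.serreDerivative k f)).coeff 0 =
      -(k / 12) * (qExpansion 1 f).coeff 0 := by
  rw [serreDerivative_eq_sub, hf.normalizedDeriv.qExpansion_sub ((isQHolo_E2.mul hf).smul _),
    (isQHolo_E2.mul hf).qExpansion_smul, isQHolo_E2.qExpansion_mul hf, map_sub,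
    hf.coeff_D]
  have h := qExpansion_E2_coeff_zero
  simp only [PowerSeries.coeff_zero_eq_constantCoeff] at h
  simp only [PowerSeries.coeff_zero_eq_constantCoeff, map_smul, map_mul, h, smul_eq_mul,
    Nat.cast_zero]
  ring

/-- The Serre derivative of a modular form. -/
def serreForm {k : ℤ} (f : ModularForm 𝒮ℒ k) : ModularForm 𝒮ℒ (k + 2) :=
  ((isQHolo_modularForm f).serreDerivative k).toModularForm fun γ =>
    serreDerivative_slash_invariant (isQHolo_modularForm f).mdiff (slash_modularForm f γ)

/-! ### Ramanujan's differential equations -/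

/-- A level one modular form of weight less than `12` is determined by its constant term. -/
theorem eq_of_coeff_zero_eq {k : ℕ} (hk : k < 12) {f g : ℍ → ℂ} (F G : ModularForm 𝒮ℒ k)
    (hF : ⇑F = f) (hG : ⇑G = g)
    (h : (qExpansion 1 f).coeff 0 = (qExpansion 1 g).coeff 0) : f = g := by
  subst hF hG
  have : F - G = 0 := by
    apply sturm_bound_levelOne_nat
    rw [Nat.div_eq_of_lt hk, FunLike.coe_sub,
      (isQHolo_modularForm F).qExpansion_sub (isQHolo_modularForm G)]
    refine lt_of_lt_of_le (b := ((1 : ℕ) : ℕ∞)) (by norm_num) (PowerSeries.nat_le_order _ _ ?_)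
    intro i hi
    obtain rfl : i = 0 := by omega
    rw [map_sub, h, sub_self]
  rw [sub_eq_zero.mp this]

theorem qExpansion_E₄_coeff_zero : (qExpansion 1 E₄).coeff 0 = 1 :=
  E_qExpansion_coeff_zero _ ⟨2, rfl⟩

theorem qExpansion_E₆_coeff_zero : (qExpansion 1 E₆).coeff 0 = 1 :=
  E_qExpansion_coeff_zero _ ⟨3, rfl⟩

theorem serreDerivative_E₄ : serreDerivative 4 E₄ = (-1 / 3 : ℂ) • ⇑E₆ := by
  apply eq_of_coeff_zero_eq (k := 6) (by norm_num)
    (ModularForm.mcast (by norm_num) (serreForm E₄)) ((-1 / 3 : ℂ) • E₆)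
  · rfl
  · simp
  · rw [(isQHolo_modularForm E₄).coeff_zero_serreDerivative,
      (isQHolo_modularForm E₆).qExpansion_smul, map_smul, qExpansion_E₄_coeff_zero,
      qExpansion_E₆_coeff_zero]
    norm_num

theorem serreDerivative_E₆ : serreDerivative 6 E₆ = (-1 / 2 : ℂ) • (⇑E₄ * ⇑E₄) := by
  have h4 := isQHolo_modularForm E₄
  apply eq_of_coeff_zero_eq (k := 8) (by norm_num)
    (ModularForm.mcast (by norm_num) (serreForm E₆))
    ((-1 / 2 : ℂ) • ModularForm.mcast (by norm_num) (E₄.mul E₄))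
  · rfl
  · rfl
  · rw [(isQHolo_modularForm E₆).coeff_zero_serreDerivative,
      (h4.mul h4).qExpansion_smul, h4.qExpansion_mul h4, map_smul]
    have h := qExpansion_E₄_coeff_zero
    have h' := qExpansion_E₆_coeff_zero
    simp only [PowerSeries.coeff_zero_eq_constantCoeff] at h h'
    simp [h, h']
    norm_num

theorem D_E₄ (z : ℍ) : D E₄ z = (E2 z * E₄ z - E₆ z) / 3 := by
  have := congrFun serreDerivative_E₄ z
  simp at this
  linear_combination this

theorem D_E₆ (z : ℍ) : D E₆ z = (E2 z * E₆ z - E₄ z ^ 2) / 2 := by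
  have := congrFun serreDerivative_E₆ z
  simp at this
  linear_combination this

theorem E2_slash_apply (γ : SL(2, ℤ)) :
    E2 ∣[(2 : ℤ)] γ = fun z => E2 z - 6 * Complex.I / Real.pi * (γ 1 0 / denom γ z) := by
  rw [E2_slash_action]
  ext z
  have := Complex.ofReal_ne_zero.mpr Real.pi_ne_zero
  simp only [Pi.sub_apply, Pi.smul_apply, D2, riemannZeta_two, smul_eq_mul]
  field_simp

theorem D_E2_slash (γ : SL(2, ℤ)) (z : ℍ) : D (E2 ∣[(2 : ℤ)] γ) z =
    D E2 z + 6 * Complex.I / Real.pi * (2 * Real.pi * Complex.I)⁻¹ *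
      (γ 1 0 / denom γ z) ^ 2 := by
  have h1 : HasDerivAt (E2 ∘ ofComplex) (deriv (E2 ∘ ofComplex) z) (z : ℂ) :=
    (UpperHalfPlane.mdifferentiableAt_iff.mp (E2_mdifferentiable z)).hasDerivAt
  have h2 := (hasDerivAt_denom_zpow (γ : GL (Fin 2) ℝ) (-1) z).const_mul
    (6 * Complex.I / Real.pi * γ 1 0)
  have h3 : (E2 ∣[(2 : ℤ)] γ) ∘ ofComplex =ᶠ[nhds (z : ℂ)] fun w =>
      (E2 ∘ ofComplex) w - 6 * Complex.I / Real.pi * γ 1 0 * denom γ w ^ (-1 : ℤ) := by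
    filter_upwards [isOpen_upperHalfPlaneSet.mem_nhds z.im_pos] with w hw
    rw [comp_apply, E2_slash_apply]
    simp only [comp_apply, ofComplex_apply_of_im_pos hw, zpow_neg_one]
    ring
  rw [normalizedDerivOfComplex, h3.deriv_eq, (h1.fun_sub h2).deriv, normalizedDerivOfComplex]
  have := denom_ne_zero γ z
  simp only [show (-1 - 1 : ℤ) = -2 by norm_num, zpow_neg, zpow_ofNat]
  simp
  field_simp
  ring

/-- With j = c/(cz+d), both D E2 and E2²/12 transform with extra terms linear and quadratic in j;
these agree and cancel in the difference. -/
theorem ramanujan_E2_slash (γ : SL(2, ℤ)) :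
    (D E2 - (12⁻¹ : ℂ) • (E2 * E2)) ∣[(4 : ℤ)] γ = D E2 - (12⁻¹ : ℂ) • (E2 * E2) := by
  have h1 := E2_slash_apply γ
  have h2 (z : ℍ) : (D E2 ∣[(4 : ℤ)] γ) z =
      D E2 z + 6 * Complex.I / Real.pi * (2 * Real.pi * Complex.I)⁻¹ * (γ 1 0 / denom γ z) ^ 2 +
        2 * (2 * Real.pi * Complex.I)⁻¹ * (γ 1 0 / denom γ z) *
          (E2 z - 6 * Complex.I / Real.pi * (γ 1 0 / denom γ z)) := by
    have := congrFun (normalizedDerivOfComplex_SL_slash (k := 2) E2_mdifferentiable (γ := γ)) z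
    rw [D_E2_slash, Pi.sub_apply, h1] at this
    exact (eq_add_of_sub_eq (Eq.symm this))
  have h3 : (E2 * E2) ∣[(4 : ℤ)] γ = (E2 ∣[(2 : ℤ)] γ) * (E2 ∣[(2 : ℤ)] γ) :=
    ModularForm.mul_slash_SL2 2 2 γ E2 E2
  ext z
  rw [sub_eq_add_neg, SlashAction.add_slash, SlashAction.neg_slash, SL_smul_slash, h3, h1]
  simp only [Pi.add_apply, Pi.neg_apply, Pi.smul_apply, Pi.mul_apply, h2, smul_eq_mul]
  have hI : (Complex.I : ℂ) ^ 2 = -1 := Complex.I_sq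
  have := Complex.ofReal_ne_zero.mpr Real.pi_ne_zero
  have hI0 := Complex.I_ne_zero
  generalize ((γ 1 0 : ℤ) : ℂ) / denom γ z = j
  field_simp
  ring_nf
  simp only [hI, show Complex.I ^ 3 = - Complex.I by rw [pow_succ, hI]; ring]
  ring

theorem D_E2 (z : ℍ) : D E2 z = (E2 z ^ 2 - E₄ z) / 12 := by
  have h2 := isQHolo_E2
  have h : D E2 - (12⁻¹ : ℂ) • (E2 * E2) = (-12⁻¹ : ℂ) • ⇑E₄ := by
    apply eq_of_coeff_zero_eq (k := 4) (by norm_num)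
      ((h2.normalizedDeriv.sub ((h2.mul h2).smul _)).toModularForm ramanujan_E2_slash)
      ((-12⁻¹ : ℂ) • E₄)
    · rfl
    · simp
    · rw [h2.normalizedDeriv.qExpansion_sub ((h2.mul h2).smul _), (h2.mul h2).qExpansion_smul,
        h2.qExpansion_mul h2, (isQHolo_modularForm E₄).qExpansion_smul, map_sub, map_smul,
        map_smul, h2.coeff_D]
      have h := qExpansion_E₄_coeff_zero
      have h' := qExpansion_E2_coeff_zero
      simp only [PowerSeries.coeff_zero_eq_constantCoeff] at h h'
      simp [h, h']
  have := congrFun h z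
  simp at this
  linear_combination this

/-! ### Pointwise calculus for D -/

/-- `f` is differentiable at `z` and `D f z = d`. -/
def HasD (f : ℍ → ℂ) (d : ℂ) (z : ℍ) : Prop :=
  HasDerivAt (f ∘ ofComplex) (2 * Real.pi * Complex.I * d) (z : ℂ)

namespace HasD

variable {f g : ℍ → ℂ} {a b : ℂ} {z : ℍ}

theorem D_eq (h : HasD f a z) : D f z = a := by
  rw [normalizedDerivOfComplex, HasDerivAt.deriv h, inv_mul_cancel_left₀ Complex.two_pi_I_ne_zero]

theorem of_mdifferentiableAt (h : MDiffAt f z) : HasD f (D f z) z := by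
  rw [HasD, normalizedDerivOfComplex, mul_inv_cancel_left₀ Complex.two_pi_I_ne_zero]
  exact (UpperHalfPlane.mdifferentiableAt_iff.mp h).hasDerivAt

theorem congr_of_isOpen {U : Set ℍ} (hU : IsOpen U) (hz : z ∈ U) (h : HasD f a z)
    (hfg : ∀ w ∈ U, f w = g w) : HasD g a z := by
  refine HasDerivAt.congr_of_eventuallyEq h ?_
  have h1 : ∀ᶠ w in nhds (z : ℂ), ofComplex w ∈ U := by
    refine (mdifferentiableAt_ofComplex z.im_pos).continuousAt.eventually_mem ?_
    simpa using hU.mem_nhds hz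
  filter_upwards [h1] with w hw using (hfg _ hw).symm

theorem congr_deriv (h : HasD f a z) (hab : a = b) : HasD f b z := hab ▸ h

theorem add (hf : HasD f a z) (hg : HasD g b z) : HasD (fun w => f w + g w) (a + b) z := by
  unfold HasD at *
  rw [mul_add]
  exact HasDerivAt.fun_add hf hg

theorem mul (hf : HasD f a z) (hg : HasD g b z) :
    HasD (fun w => f w * g w) (a * g z + f z * b) z := by
  have h := HasDerivAt.fun_mul hf hg
  simp only [comp_apply, ofComplex_apply] at h
  unfold HasD
  convert! h using 1
  ring

theorem const_mul (c : ℂ) (hf : HasD f a z) : HasD (fun w => c * f w) (c * a) z := by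
  have h := HasDerivAt.const_mul c hf
  unfold HasD
  convert! h using 1
  ring

theorem inv (hf : HasD f a z) (h0 : f z ≠ 0) : HasD (fun w => (f w)⁻¹) (-a / f z ^ 2) z := by
  have h := HasDerivAt.fun_inv hf (by simpa using h0)
  simp only [comp_apply, ofComplex_apply] at h
  unfold HasD
  convert! h using 1
  ring

theorem pow (hf : HasD f a z) (n : ℕ) : HasD (fun w => f w ^ n) (n * f z ^ (n - 1) * a) z := by
  have h := HasDerivAt.fun_pow hf n
  simp only [comp_apply, ofComplex_apply] at h
  unfold HasD
  convert! h using 1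
  ring

end HasD

/-- The logarithmic derivative of η under D is E2/24, and Δ^{1/2} = η¹². -/
theorem hasD_sqrtDelta (z : ℍ) : HasD sqrtDelta (E2 z / 2 * sqrtDelta z) z := by
  have h : HasD (fun w : ℍ => eta w) (E2 z / 24 * eta z) z := by
    have h1 := (differentiableAt_eta_of_mem_upperHalfPlaneSet z.2).hasDerivAt
    have h2 := logDeriv_eta_eq_E2 z
    rw [logDeriv_apply, div_eq_iff (eta_ne_zero z.2)] at h2
    rw [h2] at h1
    have h3 : HasDerivAt eta (2 * Real.pi * Complex.I * (E2 z / 24 * eta z)) (z : ℂ) := by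
      convert! h1 using 1; ring
    refine HasDerivAt.congr_of_eventuallyEq h3 ?_
    filter_upwards [isOpen_upperHalfPlaneSet.mem_nhds z.im_pos] with w hw
    simp [ofComplex_apply_of_im_pos hw]
  refine (h.pow 12).congr_deriv ?_
  simp only [sqrtDelta]
  push_cast
  ring

theorem hasD_E₄ (z : ℍ) : HasD E₄ ((E2 z * E₄ z - E₆ z) / 3) z :=
  (HasD.of_mdifferentiableAt ((isQHolo_modularForm E₄).mdiff z)).congr_deriv (D_E₄ z)

theorem hasD_E₆ (z : ℍ) : HasD E₆ ((E2 z * E₆ z - E₄ z ^ 2) / 2) z :=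
  (HasD.of_mdifferentiableAt ((isQHolo_modularForm E₆).mdiff z)).congr_deriv (D_E₆ z)

theorem hasD_E2 (z : ℍ) : HasD E2 ((E2 z ^ 2 - E₄ z) / 12) z :=
  (HasD.of_mdifferentiableAt (isQHolo_E2.mdiff z)).congr_deriv (D_E2 z)

theorem sqrtDelta_sq_eq (z : ℍ) : sqrtDelta z ^ 2 = (E₄ z ^ 3 - E₆ z ^ 2) / 1728 := by
  rw [sqrtDelta_sq, discriminant_eq_E₄_cube_sub_E₆_sq]

theorem IsSqrtE4On.hasD {U : Set ℍ} {r : ℍ → ℂ} (hr : IsSqrtE4On U r) {z : ℍ} (hz : z ∈ U) :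
    HasD r ((E2 z - E₆ z / E₄ z) / 6 * r z) z := by
  have h1 := HasD.of_mdifferentiableAt
    ((hr.mdifferentiableOn z hz).mdifferentiableAt (hr.isOpen.mem_nhds hz))
  refine h1.congr_deriv ?_
  have h2 := ((h1.pow 2).congr_of_isOpen hr.isOpen hz hr.sq_eq).D_eq
  rw [D_E₄] at h2
  have h4 := hr.ne_zero z hz
  have h5 := hr.sq_eq z hz
  have hr0 : r z ≠ 0 := fun h => h4 (by rw [← h5, h]; ring)
  have h6 : 2 * r z * D r z = 2 * r z * ((E2 z - E₆ z / E₄ z) / 6 * r z) := by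
    calc 2 * r z * D r z = (E2 z * E₄ z - E₆ z) / 3 := by rw [h2]; simp
      _ = (E2 z - E₆ z / E₄ z) / 3 * E₄ z := by field_simp
      _ = _ := by rw [← h5]; ring
  exact mul_left_cancel₀ (mul_ne_zero two_ne_zero hr0) h6

/-! ### The first order system and the differential equation -/

/-- `g` and `h`, of weights `6k + 2` and `6k + 8`, are related by a first order system. -/
structure Ladder (k : ℕ) (g h : ℍ → ℂ) (a b : ℂ) : Prop where
  mul_eq : a * b = 12 * (6 * k + 7) * (6 * k - 1)
  mdiff_left : MDiff g
  mdiff_right : MDiff h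
  left : ∀ z, E₄ z * (D g z - (6 * k + 1) / 12 * E2 z * g z) =
    (6 * k - 1) / 12 * E₆ z * g z + a * h z
  right : ∀ z, E₄ z * (D h z - (6 * k + 7) / 12 * E2 z * h z) =
    -(6 * k + 7) / 12 * E₆ z * h z + b * sqrtDelta z ^ 2 * g z

theorem hasD_phi {U : Set ℍ} {r : ℍ → ℂ} (hr : IsSqrtE4On U r) {z : ℍ} (hz : z ∈ U) (k : ℕ)
    {f : ℍ → ℂ} (hf : MDiff f) :
    HasD (phi k f r) (D f z * (sqrtDelta z ^ k)⁻¹ * (r z)⁻¹ -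
      (k / 2 * E2 z + (E2 z - E₆ z / E₄ z) / 6) * phi k f r z) z := by
  have h4 := hr.ne_zero z hz
  have h5 := hr.sq_eq z hz
  have hr0 : r z ≠ 0 := fun h => h4 (by rw [← h5, h]; ring)
  have hs := sqrtDelta_ne_zero z
  have h1 := HasD.of_mdifferentiableAt (hf z)
  have h2 := ((hasD_sqrtDelta z).pow k).inv (pow_ne_zero k hs)
  have h3 := (hr.hasD hz).inv hr0
  refine ((h1.mul h2).mul h3).congr_deriv ?_
  unfold phi
  -- At k = 0 the truncated exponent k - 1 is harmless, since the factor k vanishes.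
  have hk : (k : ℂ) * sqrtDelta z ^ (k - 1) * sqrtDelta z = k * sqrtDelta z ^ k := by
    cases k with
    | zero => simp
    | succ n => simp only [Nat.add_sub_cancel]; ring
  have hk' : (k : ℂ) * sqrtDelta z ^ (k - 1) * (E2 z / 2 * sqrtDelta z) =
    k / 2 * E2 z * sqrtDelta z ^ k := by linear_combination E2 z / 2 * hk
  rw [hk']
  field_simp
  ring

theorem Ladder.hasD_left {k : ℕ} {g h : ℍ → ℂ} {a b : ℂ} (H : Ladder k g h a b)
    {U : Set ℍ} {r : ℍ → ℂ} (hr : IsSqrtE4On U r) {z : ℍ} (hz : z ∈ U) :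
    HasD (phi k g r) (-(1 / 12) * (E2 z * phi k g r z) +
      ((k / 2 + 1 / 12) * (E₆ z * (E₄ z)⁻¹ * phi k g r z) +
        a * (sqrtDelta z * (E₄ z)⁻¹ * phi (k + 1) h r z))) z := by
  refine (hasD_phi hr hz k H.mdiff_left).congr_deriv ?_
  have h4 := hr.ne_zero z hz
  have hs := sqrtDelta_ne_zero z
  have hl := H.left z
  have h5 : D g z = (6 * k + 1) / 12 * E2 z * g z +
      (E₄ z)⁻¹ * ((6 * k - 1) / 12 * E₆ z * g z + a * h z) := by
    rw [← hl, inv_mul_cancel_left₀ h4]; ring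
  rw [h5]
  unfold phi
  rw [pow_succ, mul_inv]
  field_simp
  ring

theorem Ladder.hasD_right {k : ℕ} {g h : ℍ → ℂ} {a b : ℂ} (H : Ladder k g h a b)
    {U : Set ℍ} {r : ℍ → ℂ} (hr : IsSqrtE4On U r) {z : ℍ} (hz : z ∈ U) :
    HasD (phi (k + 1) h r) (-(1 / 12) * (E2 z * phi (k + 1) h r z) +
      (-(k / 2 + 5 / 12) * (E₆ z * (E₄ z)⁻¹ * phi (k + 1) h r z) +
        b * (sqrtDelta z * (E₄ z)⁻¹ * phi k g r z))) z := by
  refine (hasD_phi hr hz (k + 1) H.mdiff_right).congr_deriv ?_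
  have h4 := hr.ne_zero z hz
  have hs := sqrtDelta_ne_zero z
  have hl := H.right z
  have h5 : D h z = (6 * k + 7) / 12 * E2 z * h z +
      (E₄ z)⁻¹ * (-(6 * k + 7) / 12 * E₆ z * h z + b * sqrtDelta z ^ 2 * g z) := by
    rw [← hl, inv_mul_cancel_left₀ h4]; ring
  rw [h5]
  unfold phi
  rw [pow_succ (sqrtDelta z) k, mul_inv]
  push_cast
  field_simp
  ring

/-- Differentiating `hasD_left` and substituting both first order equations, the terms in `E2` and
in φ_{k+1} cancel. The term abΔ/E₄² φ_k supplies the remaining part of the potential. -/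
theorem Ladder.D_D_phi {k : ℕ} {g h : ℍ → ℂ} {a b : ℂ} (H : Ladder k g h a b)
    {U : Set ℍ} {r : ℍ → ℂ} (hr : IsSqrtE4On U r) {z : ℍ} (hz : z ∈ U) :
    D (D (phi k g r)) z =
      (((k : ℂ) ^ 2 / 4 - 1 / 12) * E₄ z + 1 / 12 * (E₆ z / E₄ z) ^ 2) * phi k g r z := by
  have h4 := hr.ne_zero z hz
  have hp := H.hasD_left hr hz
  have hq := H.hasD_right hr hz
  have hi := (hasD_E₄ z).inv h4
  have h1 := (((hasD_E2 z).mul hp).const_mul (-(1 / 12))).add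
    (((((hasD_E₆ z).mul hi).mul hp).const_mul (k / 2 + 1 / 12 : ℂ)).add
      ((((hasD_sqrtDelta z).mul hi).mul hq).const_mul a))
  rw [(h1.congr_of_isOpen (g := D (phi k g r)) hr.isOpen hz
    fun w hw => (H.hasD_left hr hw).D_eq.symm).D_eq]
  have hd := sqrtDelta_sq_eq z
  have hab := H.mul_eq
  generalize phi k g r z = p at *
  generalize phi (k + 1) h r z = q at *
  have hkey : a * b * sqrtDelta z ^ 2 =
    12 * (6 * k + 7) * (6 * k - 1) * ((E₄ z ^ 3 - E₆ z ^ 2) / 1728) := by rw [hab, hd]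
  field_simp
  field_simp at hkey
  linear_combination 4 * p * hkey

/-! ### Climbing the ladder -/

theorem isQHolo_discriminant : IsQHolo discriminant := by
  have h := isQHolo_modularForm
    (ModularFormClass.modularForm CuspForm.discriminant : ModularForm 𝒮ℒ 12)
  exact h

/-- The left equation at k+1 is the right equation at k rewritten: the `E₆` coefficients -(6k+7)/12
and (6k+5)/12 differ by k+1, which forces -(k+1) h' = -(k+1) E₆ h + bΔg. The new b is then fixed by
the prescribed product. -/
theorem Ladder.next {k : ℕ} {g h : ℍ → ℂ} {a b : ℂ} (H : Ladder k g h a b) {h' : ℍ → ℂ}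
    (hh' : ∀ z, h' z = E₆ z * h z + (-b / (k + 1)) * (sqrtDelta z ^ 2 * g z)) :
    Ladder (k + 1) h h' (-(k + 1)) (-12 * (6 * k + 13) * (6 * k + 5) / (k + 1)) := by
  have hk : (k : ℂ) + 1 ≠ 0 := Nat.cast_add_one_ne_zero k
  obtain rfl : h' = ⇑E₆ * h + (-b / (k + 1)) • (discriminant * g) := by
    ext z; simp [hh', sqrtDelta_sq]
  refine ⟨?_, H.mdiff_right, ?_, fun z => ?_, fun z => ?_⟩
  · push_cast; field_simp; ring
  · exact ((isQHolo_modularForm E₆).mdiff.mul H.mdiff_right).add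
      ((isQHolo_discriminant.mdiff.mul H.mdiff_left).const_smul _)
  · have := H.right z
    rw [hh']
    push_cast
    field_simp
    linear_combination 12 * this
  · have hr := H.right z
    have hl := H.left z
    have hg := HasD.of_mdifferentiableAt (H.mdiff_left z)
    have hh := HasD.of_mdifferentiableAt (H.mdiff_right z)
    have hd := (((hasD_E₆ z).mul hh).add
      ((((hasD_sqrtDelta z).pow 2).mul hg).const_mul (-b / (k + 1)))).congr_of_isOpen
        isOpen_univ (Set.mem_univ z) (fun w _ => (hh' w).symm)
    rw [hd.D_eq, hh']
    -- The -E₄²/2 in D E₆, times the outer factor `E₄`, produces E₄³, which is traded for Δ and E₆².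
    have hs : E₄ z ^ 3 = 1728 * sqrtDelta z ^ 2 + E₆ z ^ 2 := by rw [sqrtDelta_sq_eq]; ring
    have hab := H.mul_eq
    have e1 : E₄ z * D h z = (6 * k + 7) / 12 * E₄ z * E2 z * h z +
      (-(6 * k + 7) / 12 * E₆ z * h z + b * sqrtDelta z ^ 2 * g z) := by linear_combination hr
    have e2 : E₄ z * D g z = (6 * k + 1) / 12 * E₄ z * E2 z * g z +
      ((6 * k - 1) / 12 * E₆ z * g z + a * h z) := by linear_combination hl
    push_cast
    field_simp
    linear_combination 24 * ((k + 1) * E₆ z * e1 - b * sqrtDelta z ^ 2 * e2 -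
      (k + 1) * h z / 2 * hs - sqrtDelta z ^ 2 * h z * hab)

/-! ### The Kaneko–Koike forms on the ladder -/

theorem kkForm_one (z : ℍ) : kkForm 1 z = (E₄ z ^ 2 - E2 z * E₆ z) / 1008 := by
  simp [kkForm, PStar, QStar, D_E₆]
  ring

theorem kkForm_two (z : ℍ) : kkForm 2 z = E₆ z * kkForm 1 z - sqrtDelta z ^ 2 * E2 z := by
  have := sqrtDelta_ne_zero z
  simp only [kkForm, PStar, QStar, show 2 - 1 = 1 from rfl, Polynomial.eval_X,
    Polynomial.eval_one, Nat.sub_self, pow_zero, Polynomial.eval_zero]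
  field_simp
  ring

theorem kkForm_add_three (n : ℕ) (z : ℍ) : kkForm (n + 3) z =
    E₆ z * kkForm (n + 2) z + muStar (n + 1) * (sqrtDelta z ^ 2 * kkForm (n + 1) z) := by
  have := sqrtDelta_ne_zero z
  simp only [kkForm, PStar, QStar, Nat.add_sub_cancel, show n + 3 - 1 = n + 2 by omega,
    show n + 2 - 1 = n + 1 by omega, Polynomial.eval_add, Polynomial.eval_mul, Polynomial.eval_X,
    Polynomial.eval_C]
  field_simp
  ring

theorem ladder_zero : Ladder 0 E2 (kkForm 1) (-84) 1 := by
  have h1 : kkForm 1 = (-1 / 504 : ℂ) • D E₆ := by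
    ext z; simp [kkForm, PStar, QStar]; ring
  refine ⟨by norm_num, isQHolo_E2.mdiff, ?_, fun z => ?_, fun z => ?_⟩
  · rw [h1]
    exact (isQHolo_modularForm E₆).normalizedDeriv.mdiff.const_smul _
  · rw [D_E2, kkForm_one]
    push_cast
    ring
  · have hd := (((((hasD_E₄ z).pow 2).add (((hasD_E2 z).mul (hasD_E₆ z)).const_mul (-1))).const_mul
      (1 / 1008)).congr_of_isOpen (g := kkForm 1) isOpen_univ (Set.mem_univ z)
        (fun w _ => by rw [kkForm_one]; ring))
    rw [hd.D_eq, kkForm_one, sqrtDelta_sq_eq]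
    push_cast
    ring

theorem ladder_succ (n : ℕ) : Ladder (n + 1) (kkForm (n + 1)) (kkForm (n + 2)) (-(n + 1))
    (-12 * (6 * n + 13) * (6 * n + 5) / (n + 1)) := by
  induction n with
  | zero =>
    have := ladder_zero.next (h' := kkForm 2) fun z => by
      rw [kkForm_two]; simp; ring
    simpa using this
  | succ n ih =>
    have := ih.next (h' := kkForm (n + 3)) fun z => by
      -- The factor -b/(n+2) demanded by `Ladder.next` is exactly μ*_{n+1}.
      rw [kkForm_add_three, muStar]
      have : (n : ℂ) + 1 ≠ 0 := Nat.cast_add_one_ne_zero n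
      have : (n : ℂ) + 1 + 1 ≠ 0 := by
        have := Nat.cast_add_one_ne_zero (R := ℂ) (n + 1)
        push_cast at this
        exact this
      push_cast
      field_simp
      ring
    exact this

/-! ### The depth one space and its dimension -/

/-- Quasimodular forms of weight `w` and depth at most one. -/
def IsQuasi (w : ℤ) (f : ℍ → ℂ) : Prop :=
  ∃ (F : ModularForm 𝒮ℒ w) (G : ModularForm 𝒮ℒ (w - 2)), f = ⇑F + ⇑G * E2

theorem IsQuasi.isQHolo {w : ℤ} {f : ℍ → ℂ} (hf : IsQuasi w f) : IsQHolo f := by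
  obtain ⟨F, G, rfl⟩ := hf
  exact (isQHolo_modularForm F).add ((isQHolo_modularForm G).mul isQHolo_E2)

theorem IsQuasi.add {w : ℤ} {f g : ℍ → ℂ} (hf : IsQuasi w f) (hg : IsQuasi w g) :
    IsQuasi w (f + g) := by
  obtain ⟨F, G, rfl⟩ := hf
  obtain ⟨F', G', rfl⟩ := hg
  refine ⟨F + F', G + G', ?_⟩
  simp only [FunLike.coe_add]
  ring

theorem IsQuasi.smul {w : ℤ} {f : ℍ → ℂ} (c : ℂ) (hf : IsQuasi w f) : IsQuasi w (c • f) := by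
  obtain ⟨F, G, rfl⟩ := hf
  refine ⟨c • F, c • G, ?_⟩
  simp only [FunLike.coe_smul]
  rw [smul_add, smul_mul_assoc]

theorem IsQuasi.mul {v w u : ℤ} {f : ℍ → ℂ} (M : ModularForm 𝒮ℒ v) (hf : IsQuasi w f)
    (h : v + w = u) : IsQuasi u (⇑M * f) := by
  obtain ⟨F, G, rfl⟩ := hf
  refine ⟨ModularForm.mcast h (M.mul F),
    ModularForm.mcast (by omega) (M.mul G), ?_⟩
  change _ = ⇑M * ⇑F + ⇑M * ⇑G * E2
  ring

theorem isQuasi_iff (w : ℕ) (f : ℍ → ℂ) : f ∈ quasimodularForms 1 w ↔ IsQuasi w f := by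
  constructor
  · rintro ⟨g, hg⟩
    refine ⟨ModularForm.mcast (by simp) (g 0), ModularForm.mcast (by simp) (g 1), ?_⟩
    ext z
    rw [hg, Finset.sum_range_succ, Finset.sum_range_one, pow_zero, pow_one, mul_one]
    rfl
  · rintro ⟨F, G, rfl⟩
    refine ⟨fun j => match j with
      | 0 => ModularForm.mcast (by simp) F
      | 1 => ModularForm.mcast (by simp) G
      | _ + 2 => 0, fun z => ?_⟩
    rw [Finset.sum_range_succ, Finset.sum_range_one, pow_zero, pow_one, mul_one]
    rfl

/-- Applying S to F = -G E2 leaves G times the anomaly of `E2`, a nowhere vanishing multiple of 1/z,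
so G = 0. -/
theorem eq_zero_of_add_mul_E2_eq_zero {w : ℤ} (F : ModularForm 𝒮ℒ w)
    (G : ModularForm 𝒮ℒ (w - 2)) (h : ⇑F + ⇑G * E2 = 0) : F = 0 ∧ G = 0 := by
  have hF : ⇑F = -(⇑G * E2) := eq_neg_of_add_eq_zero_left h
  have hG : G = 0 := by
    ext z
    have h1 := slash_modularForm F ModularGroup.S
    have h3 : (⇑G * E2) ∣[w] ModularGroup.S =
        (⇑G ∣[w - 2] ModularGroup.S) * (E2 ∣[(2 : ℤ)] ModularGroup.S) := by
      have := ModularForm.mul_slash_SL2 (w - 2) 2 ModularGroup.S ⇑G E2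
      rwa [sub_add_cancel] at this
    rw [hF, SlashAction.neg_slash, h3, slash_modularForm, E2_slash_apply] at h1
    have h2 := congrFun h1 z
    simp only [Pi.neg_apply, Pi.mul_apply] at h2
    have hS : ((ModularGroup.S 1 0 : ℤ) : ℂ) = 1 := by simp [ModularGroup.S]
    rw [hS] at h2
    have hd := denom_ne_zero ModularGroup.S z
    have hpi := Complex.ofReal_ne_zero.mpr Real.pi_ne_zero
    have h4 : G z * (6 * Complex.I / Real.pi * (1 / denom ModularGroup.S z)) = 0 := by
      linear_combination h2
    refine (mul_eq_zero.mp h4).resolve_right ?_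
    exact mul_ne_zero (div_ne_zero (mul_ne_zero (by norm_num) Complex.I_ne_zero) hpi)
      (one_div_ne_zero hd)
  refine ⟨?_, hG⟩
  ext z
  rw [hF, hG]
  simp

/-- Depth one quasimodular forms as pairs of modular forms. -/
def quasiMap (w : ℤ) :
    (ModularForm 𝒮ℒ w × ModularForm 𝒮ℒ (w - 2)) →ₗ[ℂ] (ℍ → ℂ) where
  toFun p := ⇑p.1 + ⇑p.2 * E2
  map_add' p q := by
    simp only [Prod.fst_add, Prod.snd_add, FunLike.coe_add]
    ring
  map_smul' c p := by
    simp only [Prod.smul_fst, Prod.smul_snd, FunLike.coe_smul, RingHom.id_apply]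
    rw [smul_add, smul_mul_assoc]

theorem quasiMap_injective (w : ℤ) : Injective (quasiMap w) := by
  rw [injective_iff_map_eq_zero]
  intro p hp
  obtain ⟨h1, h2⟩ := eq_zero_of_add_mul_E2_eq_zero p.1 p.2 hp
  exact Prod.ext h1 h2

theorem range_quasiMap (w : ℕ) : LinearMap.range (quasiMap w) = quasimodularForms 1 w := by
  ext f
  rw [isQuasi_iff]
  constructor
  · rintro ⟨p, rfl⟩
    exact ⟨p.1, p.2, rfl⟩
  · rintro ⟨F, G, rfl⟩
    exact ⟨(F, G), rfl⟩

theorem finrank_modularForm (w : ℕ) (hw : Even w) :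
    Module.finrank ℂ (ModularForm 𝒮ℒ w) = if w ≡ 2 [MOD 12] then w / 12 else w / 12 + 1 := by
  rw [Module.finrank, dimension_level_one w hw]
  split_ifs <;> simp

theorem finrank_quasimodularForms (k : ℕ) :
    Module.finrank ℂ (quasimodularForms 1 (6 * k + 2)) = k + 1 := by
  rw [← range_quasiMap, LinearMap.finrank_range_of_inj (quasiMap_injective _),
    Module.finrank_prod, finrank_modularForm _ ⟨3 * k + 1, by ring⟩,
    show ((6 * k + 2 : ℕ) : ℤ) - 2 = ((6 * k : ℕ) : ℤ) by push_cast; ring,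
    finrank_modularForm _ ⟨3 * k, by ring⟩]
  -- Weights 6k+2 and 6k contribute j + (j+1) for k = 2j and (j+1) + (j+1) for k = 2j+1.
  rcases Nat.even_or_odd' k with ⟨j, rfl | rfl⟩
  · rw [if_pos (by unfold Nat.ModEq; omega), if_neg (by unfold Nat.ModEq; omega)]
    omega
  · rw [if_neg (by unfold Nat.ModEq; omega), if_neg (by unfold Nat.ModEq; omega)]
    omega

/-! ### Uniqueness by a Wronskian argument -/

open PowerSeries in
theorem exists_eq_X_pow_mul {A : PowerSeries ℂ} (hA : A ≠ 0) :
    ∃ (n : ℕ) (B : PowerSeries ℂ), A = X ^ n * B ∧ constantCoeff B ≠ 0 :=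
  ⟨A.order.toNat, A.divXPowOrder, X_pow_order_mul_divXPowOrder.symm,
    (constantCoeff_divXPowOrder_eq_zero_iff.not).mpr hA⟩

-- Formally the hypothesis says q d/dq (B/A) = -1/12, impossible because q d/dq kills the constant
-- term of a Laurent series. The proof compares leading terms according to the orders n of A and r
-- of B.
open PowerSeries in
theorem eq_zero_of_wronskian_eq {A B : PowerSeries ℂ}
    (h : B * (X * derivative ℂ A) - A * (X * derivative ℂ B) = (12⁻¹ : ℂ) • (A * A)) : A = 0 := by
  by_contra hA
  have hB : B ≠ 0 := by
    rintro rfl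
    refine smul_ne_zero (by norm_num) (mul_ne_zero hA hA) (h.symm.trans ?_)
    simp
  obtain ⟨n, A, rfl, hA0⟩ := exists_eq_X_pow_mul hA
  obtain ⟨r, B, rfl, hB0⟩ := exists_eq_X_pow_mul hB
  have hd (n : ℕ) (A : PowerSeries ℂ) : X * derivative ℂ (X ^ n * A) =
      X ^ n * ((n : ℂ) • A + X * derivative ℂ A) := by
    cases n with
    | zero => simp
    | succ n =>
      rw [Derivation.leibniz, Derivation.leibniz_pow, smul_eq_C_mul]
      simp only [smul_eq_mul, derivative_X, nsmul_eq_mul, Nat.add_sub_cancel, map_natCast]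
      ring
  rw [hd, hd] at h
  have h1 : X ^ (n + r) * (((n : ℂ) - r) • (A * B) + X * (B * derivative ℂ A - A * derivative ℂ B))
      = X ^ (n + n) * ((12⁻¹ : ℂ) • (A * A)) := by
    simp only [smul_eq_C_mul, map_sub] at h ⊢
    linear_combination h
  rcases lt_trichotomy r n with hrn | rfl | hrn
  · obtain ⟨m, rfl⟩ := Nat.exists_eq_add_of_lt hrn
    rw [show r + m + 1 + (r + m + 1) = (r + m + 1 + r) + (m + 1) by ring, pow_add _ _ (m + 1),
      mul_assoc] at h1
    have h2 := congrArg constantCoeff (mul_left_cancel₀ (pow_ne_zero _ X_ne_zero) h1)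
    have hm : (m : ℂ) + 1 ≠ 0 := Nat.cast_add_one_ne_zero m
    simp [smul_eq_C_mul, hA0, hB0] at h2
    exact hm (by linear_combination h2)
  · have h2 := congrArg constantCoeff (mul_left_cancel₀ (pow_ne_zero _ X_ne_zero) h1)
    simp [smul_eq_C_mul, hA0] at h2
  · obtain ⟨m, rfl⟩ := Nat.exists_eq_add_of_lt hrn
    rw [show n + (n + m + 1) = (n + n) + (m + 1) by ring, pow_add _ _ (m + 1), mul_assoc] at h1
    have h2 := congrArg constantCoeff (mul_left_cancel₀ (pow_ne_zero _ X_ne_zero) h1)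
    simp [smul_eq_C_mul, hA0] at h2

/-- A depth one form of weight `6k + 2` which vanishes to order greater than `k` is zero. -/
theorem IsQuasi.eq_zero {k : ℕ} {f : ℍ → ℂ} (hf : IsQuasi (6 * k + 2) f)
    (h : PowerSeries.X ^ (k + 1) ∣ qExpansion 1 f) : f = 0 := by
  have hfq := hf.isQHolo
  obtain ⟨F, G, hFG⟩ := hf
  have hF := isQHolo_modularForm F
  have hG := isQHolo_modularForm G
  -- For f = F + G E2 the combination G Df - f DG - f²/12 is free of `E2`: it is a genuine modular
  -- form. Each term is divisible by f or Df, so it inherits vanishing to order k+1, beyond the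
  -- Sturm bound k.
  let W : ModularForm 𝒮ℒ ((12 * k + 4 : ℕ) : ℤ) :=
    ModularForm.mcast (by push_cast; ring) (G.mul (serreForm F)) -
    ModularForm.mcast (by push_cast; ring) (F.mul (serreForm G)) -
    (12⁻¹ : ℂ) • (ModularForm.mcast (by push_cast; ring) ((G.mul G).mul E₄)) -
    (12⁻¹ : ℂ) • (ModularForm.mcast (by push_cast; ring) (F.mul F))
  have hW : ⇑W = ⇑G * D f - f * D G - (12⁻¹ : ℂ) • (f * f) := by
    ext z
    have hDf : D f z = D F z + (D G z * E2 z + G z * ((E2 z ^ 2 - E₄ z) / 12)) := by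
      rw [hFG]
      exact ((HasD.of_mdifferentiableAt (hF.mdiff z)).add
        ((HasD.of_mdifferentiableAt (hG.mdiff z)).mul (hasD_E2 z))).D_eq
    have hfz : f z = F z + G z * E2 z := by rw [hFG]; rfl
    have hWz : W z = G z * serreDerivative ((6 * k + 2 : ℤ) : ℂ) F z -
      F z * serreDerivative ((6 * k + 2 - 2 : ℤ) : ℂ) G z - 12⁻¹ * (G z * G z * E₄ z) -
      12⁻¹ * (F z * F z) := rfl
    rw [hWz]
    simp only [Pi.sub_apply, Pi.mul_apply, Pi.smul_apply, smul_eq_mul, hDf, hfz,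
      serreDerivative_apply]
    push_cast
    ring
  have hq : qExpansion 1 W = qExpansion 1 G * (PowerSeries.X *
      PowerSeries.derivative ℂ (qExpansion 1 f)) - qExpansion 1 f * (PowerSeries.X *
      PowerSeries.derivative ℂ (qExpansion 1 G)) -
      (12⁻¹ : ℂ) • (qExpansion 1 f * qExpansion 1 f) := by
    rw [hW, ((hG.mul hfq.normalizedDeriv).sub (hfq.mul hG.normalizedDeriv)).qExpansion_sub
      ((hfq.mul hfq).smul _), (hG.mul hfq.normalizedDeriv).qExpansion_sub
      (hfq.mul hG.normalizedDeriv), hG.qExpansion_mul hfq.normalizedDeriv,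
      hfq.qExpansion_mul hG.normalizedDeriv, (hfq.mul hfq).qExpansion_smul,
      hfq.qExpansion_mul hfq, hfq.qExpansion_D, hG.qExpansion_D]
  have hD : PowerSeries.X ^ (k + 1) ∣ PowerSeries.X *
      PowerSeries.derivative ℂ (qExpansion 1 f) := by
    rw [← hfq.qExpansion_D, PowerSeries.X_pow_dvd_iff]
    intro m hm
    rw [hfq.coeff_D, PowerSeries.X_pow_dvd_iff.mp h m hm, mul_zero]
  have hdvd : PowerSeries.X ^ (k + 1) ∣ qExpansion 1 W := by
    rw [hq]
    refine dvd_sub (dvd_sub (hD.mul_left _) (h.mul_right _)) ?_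
    rw [PowerSeries.smul_eq_C_mul]
    exact (h.mul_right _).mul_left _
  have hW0 : W = 0 := by
    apply sturm_bound_levelOne_nat
    refine lt_of_lt_of_le ?_ (PowerSeries.nat_le_order _ (k + 1)
      (PowerSeries.X_pow_dvd_iff.mp hdvd))
    rw [show (12 * k + 4) / 12 = k by omega]
    exact_mod_cast Nat.lt_succ_self k
  have hz : qExpansion 1 W = 0 := by
    rw [hW0]; exact qExpansion_zero 1
  refine hfq.eq_zero_of_qExpansion (eq_zero_of_wronskian_eq (B := qExpansion 1 G) ?_)
  rw [hz] at hq
  exact (sub_eq_zero.mp hq.symm)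

/-! ### Vanishing order along the ladder -/

theorem coeff_mul_of_X_pow_dvd {A : PowerSeries ℂ} {n : ℕ} (h : PowerSeries.X ^ n ∣ A)
    (P : PowerSeries ℂ) : (P * A).coeff n = P.coeff 0 * A.coeff n := by
  obtain ⟨B, rfl⟩ := h
  rw [mul_left_comm]
  have h1 := PowerSeries.coeff_X_pow_mul (P * B) n 0
  have h2 := PowerSeries.coeff_X_pow_mul B n 0
  rw [zero_add] at h1 h2
  rw [h1, h2]
  simp

theorem Ladder.ne_zero {k : ℕ} {g h : ℍ → ℂ} {a b : ℂ} (H : Ladder k g h a b) :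
    a ≠ 0 ∧ b ≠ 0 := by
  rw [← mul_ne_zero_iff, H.mul_eq]
  have h1 : (6 * k + 7 : ℂ) ≠ 0 := by exact_mod_cast (by omega : 6 * k + 7 ≠ 0)
  have h2 : (6 * k - 1 : ℂ) ≠ 0 := by
    have : (6 * k - 1 : ℤ) ≠ 0 := by omega
    exact_mod_cast this
  exact mul_ne_zero (mul_ne_zero (by norm_num) h1) h2

/-- If h = 0, the right equation reduces to bΔg = 0 with b and Δ nonzero. -/
theorem Ladder.right_ne_zero {k : ℕ} {g h : ℍ → ℂ} {a b : ℂ} (H : Ladder k g h a b)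
    (hg : g ≠ 0) : h ≠ 0 := by
  rintro rfl
  refine hg (funext fun z => ?_)
  have h1 := H.right z
  have h2 : D (0 : ℍ → ℂ) z = 0 := congrFun (normalizedDerivOfComplex_const 0) z
  rw [h2] at h1
  simpa [H.ne_zero.2, sqrtDelta_ne_zero] using h1

/-- The left equation expresses h through g, and the constants are such that the q^k coefficient
cancels. -/
theorem Ladder.isQHolo_right {k : ℕ} {g h : ℍ → ℂ} {a b : ℂ} (H : Ladder k g h a b)
    (hg : IsQHolo g) (hk : PowerSeries.X ^ k ∣ qExpansion 1 g) :
    IsQHolo h ∧ PowerSeries.X ^ (k + 1) ∣ qExpansion 1 h := by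
  have h4 := isQHolo_modularForm E₄
  have h6 := isQHolo_modularForm E₆
  have hs := hg.serreDerivative (6 * k + 1)
  have hh : h = a⁻¹ • (⇑E₄ * serreDerivative (6 * k + 1) g -
      ((6 * k - 1) / 12 : ℂ) • (⇑E₆ * g)) := by
    ext z
    have h1 := H.left z
    have h2 := H.ne_zero.1
    simp only [Pi.smul_apply, Pi.sub_apply, Pi.mul_apply, smul_eq_mul, serreDerivative_apply]
    rw [eq_inv_mul_iff_mul_eq₀ h2]
    linear_combination -h1
  have h0 : IsQHolo (⇑E₄ * serreDerivative (6 * k + 1) g -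
      ((6 * k - 1) / 12 : ℂ) • (⇑E₆ * g)) := (h4.mul hs).sub ((h6.mul hg).smul _)
  refine ⟨hh ▸ h0.smul _, ?_⟩
  have hcoeff (n : ℕ) (hn : PowerSeries.X ^ n ∣ qExpansion 1 g) :
      (qExpansion 1 (serreDerivative (6 * k + 1) g)).coeff n =
        (n - (6 * k + 1) / 12) * (qExpansion 1 g).coeff n := by
    rw [serreDerivative_eq_sub, hg.normalizedDeriv.qExpansion_sub ((isQHolo_E2.mul hg).smul _),
      (isQHolo_E2.mul hg).qExpansion_smul, isQHolo_E2.qExpansion_mul hg, map_sub, map_smul,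
      hg.coeff_D, coeff_mul_of_X_pow_dvd hn, qExpansion_E2_coeff_zero, smul_eq_mul]
    ring
  have hk' (n : ℕ) (hn : n ≤ k) : PowerSeries.X ^ n ∣ qExpansion 1 g :=
    (pow_dvd_pow _ hn).trans hk
  have hsk : PowerSeries.X ^ k ∣ qExpansion 1 (serreDerivative (6 * k + 1) g) := by
    rw [PowerSeries.X_pow_dvd_iff]
    intro m hm
    rw [hcoeff m (hk' m hm.le), PowerSeries.X_pow_dvd_iff.mp hk m hm, mul_zero]
  rw [PowerSeries.X_pow_dvd_iff]
  intro m hm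
  have hmk : m ≤ k := by omega
  rw [hh, h0.qExpansion_smul, (h4.mul hs).qExpansion_sub ((h6.mul hg).smul _),
    h4.qExpansion_mul hs, (h6.mul hg).qExpansion_smul, h6.qExpansion_mul hg, map_smul, map_sub,
    map_smul, coeff_mul_of_X_pow_dvd (hk' m hmk),
    coeff_mul_of_X_pow_dvd ((pow_dvd_pow _ hmk).trans hsk), hcoeff m (hk' m hmk),
    qExpansion_E₄_coeff_zero, qExpansion_E₆_coeff_zero]
  rcases hmk.lt_or_eq with hlt | rfl
  · simp [PowerSeries.X_pow_dvd_iff.mp hk m hlt]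
  -- The leading factor is k - (6k+1)/12 - (6k-1)/12 = 0.
  · simp only [smul_eq_mul]
    ring

theorem E2_ne_zero : (E2 : ℍ → ℂ) ≠ 0 := by
  intro h
  have h1 := qExpansion_E2_coeff_zero
  rw [h, qExpansion_zero] at h1
  simp at h1

theorem kkForm_succ_props (n : ℕ) : IsQHolo (kkForm (n + 1)) ∧
    PowerSeries.X ^ (n + 1) ∣ qExpansion 1 (kkForm (n + 1)) ∧ kkForm (n + 1) ≠ 0 := by
  induction n with
  | zero =>
    obtain ⟨h1, h2⟩ := ladder_zero.isQHolo_right isQHolo_E2 (by simp)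
    exact ⟨h1, h2, ladder_zero.right_ne_zero E2_ne_zero⟩
  | succ n ih =>
    obtain ⟨h1, h2⟩ := (ladder_succ n).isQHolo_right ih.1 ih.2.1
    exact ⟨h1, h2, (ladder_succ n).right_ne_zero ih.2.2⟩

/-! ### Extremal forms are multiples of the ladder forms -/

theorem isQuasi_E2 : IsQuasi 2 E2 :=
  ⟨0, ModularForm.mcast (by norm_num) (1 : ModularForm 𝒮ℒ 0), by
    change E2 = 0 + 1 * E2
    rw [zero_add, one_mul]⟩

theorem isQuasi_kkForm_one : IsQuasi 8 (kkForm 1) := by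
  refine ⟨(1 / 1008 : ℂ) • ModularForm.mcast (by norm_num) (E₄.mul E₄),
    (-1 / 1008 : ℂ) • ModularForm.mcast (by norm_num) E₆, ?_⟩
  ext z
  rw [kkForm_one]
  change _ = 1 / 1008 * (E₄ z * E₄ z) + -1 / 1008 * E₆ z * E2 z
  ring

/-- The discriminant as a modular form. -/
def discriminantForm : ModularForm 𝒮ℒ 12 := ModularFormClass.modularForm CuspForm.discriminant

theorem IsQuasi.recurrence {w : ℤ} {f g h : ℍ → ℂ} (c : ℂ) (hf : IsQuasi w f)
    (hg : IsQuasi (w + 6) g)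
    (hh : ∀ z, h z = E₆ z * g z + c * (sqrtDelta z ^ 2 * f z)) : IsQuasi (w + 12) h := by
  have h1 : h = ⇑E₆ * g + c • (⇑discriminantForm * f) := by
    ext z
    rw [hh, sqrtDelta_sq]
    rfl
  rw [h1]
  exact (hg.mul E₆ (by ring)).add ((hf.mul discriminantForm (by ring)).smul c)

theorem isQuasi_kkForm (n : ℕ) : IsQuasi (6 * (n + 1 : ℕ) + 2) (kkForm (n + 1)) := by
  have h (n : ℕ) : IsQuasi (6 * (n + 1 : ℕ) + 2) (kkForm (n + 1)) ∧
      IsQuasi (6 * (n + 1 : ℕ) + 2 + 6) (kkForm (n + 2)) := by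
    induction n with
    | zero =>
      refine ⟨isQuasi_kkForm_one, ?_⟩
      exact isQuasi_E2.recurrence (-1) isQuasi_kkForm_one fun z => by rw [kkForm_two]; ring
    | succ n ih =>
      have h2 := ih.1.recurrence _ ih.2 (kkForm_add_three n)
      rw [show (6 * (n + 1 : ℕ) + 2 + 6 : ℤ) = 6 * (n + 1 + 1 : ℕ) + 2 by push_cast; ring] at ih
      rw [show (6 * (n + 1 : ℕ) + 2 + 12 : ℤ) = 6 * (n + 1 + 1 : ℕ) + 2 + 6 by
        push_cast; ring] at h2
      exact ⟨ih.2, h2⟩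
  exact (h n).1

/-- An extremal form of weight `6k + 2` and depth one is a multiple of any nonzero form of the
same type which vanishes to order at least `k`. -/
theorem IsExtremal.exists_smul_eq {k : ℕ} {f g : ℍ → ℂ} (hf : IsExtremal 1 (6 * k + 2) f)
    (hg : IsQuasi (6 * k + 2) g) (hgk : PowerSeries.X ^ k ∣ qExpansion 1 g) :
    ∃ c : ℂ, g = c • f := by
  have hfq : IsQuasi (6 * k + 2) f := by
    have := (isQuasi_iff _ _).mp hf.mem
    exact_mod_cast this
  have hcoeff := hf.coeff_ne_zero
  have hzero := hf.coeff_eq_zero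
  rw [finrank_quasimodularForms] at hcoeff hzero
  rw [Nat.add_sub_cancel] at hcoeff
  -- The dimension is k+1, so the nonzero coefficient of f is the k-th; this c makes g - c f vanish
  -- to order k+1.
  set c := (qExpansion 1 g).coeff k / (qExpansion 1 f).coeff k with hc
  refine ⟨c, ?_⟩
  have hgf : IsQuasi (6 * k + 2) (g + (-c) • f) := hg.add (hfq.smul _)
  have h0 : g + (-c) • f = 0 := by
    refine hgf.eq_zero ?_
    rw [hg.isQHolo.qExpansion_add (hfq.isQHolo.smul _), hfq.isQHolo.qExpansion_smul,
      PowerSeries.X_pow_dvd_iff]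
    intro m hm
    rw [map_add, map_smul, smul_eq_mul]
    rcases (Nat.lt_succ_iff.mp hm).lt_or_eq with h | rfl
    · rw [hzero m (by omega), PowerSeries.X_pow_dvd_iff.mp hgk m h]
      ring
    · rw [hc]
      field_simp
      ring
  ext z
  have := congrFun h0 z
  simp only [Pi.add_apply, Pi.smul_apply, Pi.zero_apply, smul_eq_mul] at this ⊢
  linear_combination this

theorem Ladder.smul {k : ℕ} {g h : ℍ → ℂ} {a b : ℂ} (H : Ladder k g h a b) (c : ℂ) :
    Ladder k (c • g) (c • h) a b where
  mul_eq := H.mul_eq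
  mdiff_left := H.mdiff_left.const_smul c
  mdiff_right := H.mdiff_right.const_smul c
  left z := by
    rw [normalizedDerivOfComplex_smul c g H.mdiff_left]
    simp only [Pi.smul_apply, smul_eq_mul]
    linear_combination c * H.left z
  right z := by
    rw [normalizedDerivOfComplex_smul c h H.mdiff_right]
    simp only [Pi.smul_apply, smul_eq_mul]
    linear_combination c * H.right z

theorem IsExtremal.exists_ladder {k : ℕ} {f : ℍ → ℂ} (hf : IsExtremal 1 (6 * k + 2) f) :
    ∃ (h : ℍ → ℂ) (a b : ℂ), Ladder k f h a b := by
  have key {g h : ℍ → ℂ} {a b : ℂ} (H : Ladder k g h a b) (hg : IsQuasi (6 * k + 2) g)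
      (hgk : PowerSeries.X ^ k ∣ qExpansion 1 g) (hg0 : g ≠ 0) :
      ∃ (h : ℍ → ℂ) (a b : ℂ), Ladder k f h a b := by
    obtain ⟨c, rfl⟩ := hf.exists_smul_eq hg hgk
    have hc : c ≠ 0 := by
      rintro rfl
      exact hg0 (zero_smul _ _)
    have h1 := H.smul c⁻¹
    rw [inv_smul_smul₀ hc] at h1
    exact ⟨_, _, _, h1⟩
  cases k with
  | zero => exact key ladder_zero (by simpa using isQuasi_E2) (by simp) E2_ne_zero
  | succ n =>
    obtain ⟨-, h1, h2⟩ := kkForm_succ_props n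
    exact key (ladder_succ n) (isQuasi_kkForm n) h1 h2

end KanekoKoike

end

/-- Let `f` be the Kaneko–Koike form of weight `6k + 2` (`k ≥ 1`), or any extremal quasimodular form
of weight `6k + 2` and depth `1` (`k ≥ 0`). For every branch `r` of `E₄^{1/2}`, the function
`φ = f Δ^{-k/2} E₄^{-1/2}` satisfies the differential equation, `D = (2πi)⁻¹ d/dz`. -/
theorem mainTheorem3 (k : ℕ) (f : ℍ → ℂ)
    (hf : (1 ≤ k ∧ f = KanekoKoike.kkForm k) ∨ KanekoKoike.IsExtremal 1 (6 * k + 2) f)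
    (U : Set ℍ) (r : ℍ → ℂ) (hr : KanekoKoike.IsSqrtE4On U r) :
    ∀ z ∈ U, D (D (KanekoKoike.phi k f r)) z =
      (((k : ℂ) ^ 2 / 4 - 1 / 12) * E₄ z + 1 / 12 * (E₆ z / E₄ z) ^ 2) *
        KanekoKoike.phi k f r z := by
  have key : ∃ (h : ℍ → ℂ) (a b : ℂ), KanekoKoike.Ladder k f h a b := by
    rcases hf with ⟨hk, rfl⟩ | hf
    · obtain ⟨n, rfl⟩ := Nat.exists_eq_add_of_le' hk
      exact ⟨_, _, _, KanekoKoike.ladder_succ n⟩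
    · exact hf.exists_ladder
  obtain ⟨h, a, b, H⟩ := key
  exact fun z hz => H.D_D_phi hr hz
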